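/- Let $A_1\in\mathbb{R}^{n_1\times m_1}$ and $A_2\in\mathbb{R}^{n_2\times m_2}$ be real matrices of ranks $n_1$ and $n_2$, respectively. For a matrix $A\in\mathbb{R}^{n\times m}$ of rank $n$ with columns $y_1,\dots,y_m$, let $Z_A=\sum_{j=1}^m[0,y_j]\subset\mathbb{R}^n$ be its zonotope. For a facet $H$ of $Z_A$ let $\eta_H\in\mathbb{R}^n\setminus\{0\}$ be a normal vector of $H$ (unique up to a non-zero factor) and let $m(H)$ be the number of non-zero coordinates of $\eta_HA\in\mathbb{R}^m$. The external zonotopal algebra of $A$ is the graded $\mathbb{R}$-algebra $$\mathcal{C}_A^{\mathrm{Ex}}=\mathbb{R}[x_1,\dots,x_n]\big/\big\langle(\eta_H\cdot(x_1,\dots,x_n))^{m(H)+1}: H\text{ a facet of }Z_A\big\rangle .$$ The matrices $A_1$ and $A_2$ are called $z$-equivalent if $m_1=m_2=m$ and there are a permutation matrix $\pi$ and an invertible diagonal matrix $D$, both of size $m\times m$, such that $V_1=V_2(\pi D)$, where $V_i\subset\mathbb{R}^{m}$ is the row space of $A_i$. Consider the conditions: 1. $\mathcal{C}_{A_1}^{\mathrm{Ex}}$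 and $\mathcal{C}_{A_2}^{\mathrm{Ex}}$ are isomorphic as ungraded $\mathbb{R}$-algebras; 2. $\mathcal{C}_{A_1}^{\mathrm{Ex}}$ and $\mathcal{C}_{A_2}^{\mathrm{Ex}}$ are isomorphic as graded $\mathbb{R}$-algebras; 3. $A_1$ and $A_2$ are $z$-equivalent. Then 1 and 2 are equivalent, and 3 implies 2. If, moreover, neither $A_1$ nor $A_2$ has a zero column, or $m_1=m_2$, then 1, 2 and 3 are equivalent. -/

import Mathlib

open scoped Pointwise

namespace Zonotopal

/-- The zonotope `Z_A`: the Minkowski sum of the segments `[0, y_j]`, where `y_j` are the columns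
of `A`. -/
def zonotope {n m : ℕ} (A : Matrix (Fin n) (Fin m) ℝ) : Set (Fin n → ℝ) :=
  ∑ j, segment ℝ (0 : Fin n → ℝ) (A.col j)

/-- `F` is a facet of the polytope `Z`: a non-empty (exposed) face of dimension `dim Z - 1`. -/
def IsFacet {n : ℕ} (Z F : Set (Fin n → ℝ)) : Prop :=
  IsExposed ℝ Z F ∧ F.Nonempty ∧
    Module.finrank ℝ (vectorSpan ℝ F) + 1 = Module.finrank ℝ (vectorSpan ℝ Z)

/-- `η` is a normal vector of `F`: it is non-zero and orthogonal to all differences of points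
of `F`. For a facet of a full-dimensional polytope it is unique up to a non-zero factor. -/
def IsNormal {n : ℕ} (η : Fin n → ℝ) (F : Set (Fin n → ℝ)) : Prop :=
  η ≠ 0 ∧ ∀ x ∈ F, ∀ y ∈ F, η ⬝ᵥ (x - y) = 0

/-- The number of non-zero coordinates of the row vector `η A`. -/
noncomputable def mult {n m : ℕ} (A : Matrix (Fin n) (Fin m) ℝ) (η : Fin n → ℝ) : ℕ :=
  hammingNorm (Matrix.vecMul η A)

/-- The linear form `η · (x_1, …, x_n)`. -/
noncomputable def linearForm {n : ℕ} (η : Fin n → ℝ) : MvPolynomial (Fin n) ℝ :=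
  ∑ i, MvPolynomial.C (η i) * MvPolynomial.X i

/-- The external zonotopal ideal, generated by the powers `(η_H · x) ^ (m(H) + 1)` where `H` runs
over the facets of the zonotope (and `η_H` over the normals of `H`; rescaling `η_H` only multiplies
the generator by a non-zero constant). -/
noncomputable def externalIdeal {n m : ℕ} (A : Matrix (Fin n) (Fin m) ℝ) :
    Ideal (MvPolynomial (Fin n) ℝ) :=
  Ideal.span {p | ∃ (H : Set (Fin n → ℝ)) (η : Fin n → ℝ),
    IsFacet (zonotope A) H ∧ IsNormal η H ∧ p = linearForm η ^ (mult A η + 1)}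

/-- The external zonotopal algebra of `A`. -/
abbrev ExternalAlgebra {n m : ℕ} (A : Matrix (Fin n) (Fin m) ℝ) : Type :=
  MvPolynomial (Fin n) ℝ ⧸ externalIdeal A

/-- The component of degree `d` of the external zonotopal algebra: the classes of the homogeneous
polynomials of degree `d`. -/
noncomputable def gradedPiece {n m : ℕ} (A : Matrix (Fin n) (Fin m) ℝ) (d : ℕ) :
    Submodule ℝ (ExternalAlgebra A) :=
  (MvPolynomial.homogeneousSubmodule (Fin n) ℝ d).map
    (Ideal.Quotient.mkₐ ℝ (externalIdeal A)).toLinearMap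

/-- Isomorphism as (ungraded) `ℝ`-algebras. -/
def AlgIsomorphic {n₁ m₁ n₂ m₂ : ℕ} (A₁ : Matrix (Fin n₁) (Fin m₁) ℝ)
    (A₂ : Matrix (Fin n₂) (Fin m₂) ℝ) : Prop :=
  Nonempty (ExternalAlgebra A₁ ≃ₐ[ℝ] ExternalAlgebra A₂)

/-- Isomorphism as graded `ℝ`-algebras. -/
def GradedAlgIsomorphic {n₁ m₁ n₂ m₂ : ℕ} (A₁ : Matrix (Fin n₁) (Fin m₁) ℝ)
    (A₂ : Matrix (Fin n₂) (Fin m₂) ℝ) : Prop :=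
  ∃ e : ExternalAlgebra A₁ ≃ₐ[ℝ] ExternalAlgebra A₂,
    ∀ d, (gradedPiece A₁ d).map e.toLinearMap = gradedPiece A₂ d

/-- `z`-equivalence of linear spaces of row vectors: `m₁ = m₂`, and `V₁ = V₂ (π D)` for a
permutation `π` and an invertible diagonal matrix `D` with diagonal `c`. -/
def SpaceZEquiv {m₁ m₂ : ℕ} (V₁ : Submodule ℝ (Fin m₁ → ℝ)) (V₂ : Submodule ℝ (Fin m₂ → ℝ)) :
    Prop :=
  m₁ = m₂ ∧ ∃ (π : Fin m₁ ≃ Fin m₂) (c : Fin m₁ → ℝ), (∀ j, c j ≠ 0) ∧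
    (V₁ : Set (Fin m₁ → ℝ)) = {v | ∃ w ∈ V₂, v = fun j => w (π j) * c j}

/-- `z`-equivalence of matrices: `z`-equivalence of their row spaces. -/
def ZEquiv {n₁ m₁ n₂ m₂ : ℕ} (A₁ : Matrix (Fin n₁) (Fin m₁) ℝ)
    (A₂ : Matrix (Fin n₂) (Fin m₂) ℝ) : Prop :=
  SpaceZEquiv (Submodule.span ℝ (Set.range A₁.row)) (Submodule.span ℝ (Set.range A₂.row))

end Zonotopal

/-! The algebra determines, and is determined by, the function `mult A` on linear forms. For every
`η`, the class of `η · x` has nilpotency order `mult A η + 1`, and no element with zero constant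
term and linear part `η` has smaller order. The upper bound, `linearForm_pow_mem`, extends the
defining relations from facet normals to all `η`. The lower bound, `mult_lt_of_pow_mem`, comes from
a map to `ℝ[φ_1, …, φ_m] / (φ_j ^ 2)` taking `η · x` to `∑ (η A)_j φ_j`.

Hence the linear part of any isomorphism, graded or not, is a linear bijection preserving `mult`
(`AlgIsomorphic.multIsomorphic`). Conversely, substituting such a bijection respects the relations
and gives a graded isomorphism (`MultIsomorphic.gradedAlgIsomorphic`).

As `mult A η` is the Hamming weight of `η A`, the comparison with `z`-equivalence is the MacWilliams
extension theorem over `ℝ`: a weight-preserving linear bijection of row spaces in the same `ℝ^m`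
permutes and rescales coordinates (`exists_equiv_smul_eq`). Without zero columns, `m` is the largest
weight, so `m₁ = m₂` is automatic. -/

namespace Zonotopal

open Matrix Module

/-! ### Faces of the zonotope and the columns orthogonal to a direction. -/

section Facets

variable {n m : ℕ} {A : Matrix (Fin n) (Fin m) ℝ} {η : Fin n → ℝ}

theorem span_col_eq_top (hA : A.rank = n) : Submodule.span ℝ (Set.range A.col) = ⊤ := by
  apply Submodule.eq_top_of_finrank_eq
  rw [← rank_eq_finrank_span_cols, hA, finrank_fin_fun]

theorem dotProduct_eq_zero_of_mem_span {s : Set (Fin n → ℝ)} (h : ∀ y ∈ s, η ⬝ᵥ y = 0)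
    {v : Fin n → ℝ} (hv : v ∈ Submodule.span ℝ s) : η ⬝ᵥ v = 0 := by
  have : Submodule.span ℝ s ≤ LinearMap.ker (dotProductEquiv ℝ (Fin n) η) :=
    Submodule.span_le.2 fun y hy => by simpa using h y hy
  simpa using this hv

theorem vecMul_eq_zero_iff (hA : A.rank = n) : η ᵥ* A = 0 ↔ η = 0 := by
  refine ⟨fun h => ?_, fun h => by simp [h]⟩
  refine dotProduct_eq_zero η fun v => ?_
  refine dotProduct_eq_zero_of_mem_span (s := Set.range A.col) ?_ (by
    rw [span_col_eq_top hA]; trivial)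
  rintro _ ⟨j, rfl⟩
  exact congrFun h j

theorem finrank_ker_dotProduct (hη : η ≠ 0) :
    finrank ℝ (LinearMap.ker (dotProductEquiv ℝ (Fin n) η)) + 1 = n := by
  have h := Dual.finrank_ker_add_one_of_ne_zero (f := dotProductEquiv ℝ (Fin n) η) (by simpa using hη)
  rwa [finrank_fin_fun] at h

/-- The span of the columns orthogonal to `η`. -/
def orthSpan (A : Matrix (Fin n) (Fin m) ℝ) (η : Fin n → ℝ) : Submodule ℝ (Fin n → ℝ) :=
  Submodule.span ℝ (A.col '' {j | (η ᵥ* A) j = 0})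

theorem col_mem_orthSpan {j : Fin m} (h : (η ᵥ* A) j = 0) : A.col j ∈ orthSpan A η :=
  Submodule.subset_span ⟨j, h, rfl⟩

theorem orthSpan_le_iff {S : Submodule ℝ (Fin n → ℝ)} :
    orthSpan A η ≤ S ↔ ∀ j, (η ᵥ* A) j = 0 → A.col j ∈ S := by
  rw [orthSpan, Submodule.span_le]
  exact ⟨fun h j hj => h ⟨j, hj, rfl⟩, by rintro h _ ⟨j, hj, rfl⟩; exact h j hj⟩

theorem dotProduct_eq_zero_of_mem_orthSpan {v : Fin n → ℝ} (hv : v ∈ orthSpan A η) :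
    η ⬝ᵥ v = 0 :=
  dotProduct_eq_zero_of_mem_span (by rintro _ ⟨j, hj, rfl⟩; exact hj) hv

theorem mem_zonotope {z : Fin n → ℝ} :
    z ∈ zonotope A ↔ ∃ t : Fin m → ℝ, (∀ j, t j ∈ Set.Icc (0 : ℝ) 1) ∧ ∑ j, t j • A.col j = z := by
  rw [zonotope, Set.mem_fintype_sum]
  constructor
  · rintro ⟨g, hg, rfl⟩
    have : ∀ j, ∃ t ∈ Set.Icc (0 : ℝ) 1, t • A.col j = g j := fun j => by
      have := hg j
      rw [segment_eq_image] at this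
      simpa using this
    choose t ht h using this
    exact ⟨t, ht, by simp [h]⟩
  · rintro ⟨t, ht, rfl⟩
    refine ⟨fun j => t j • A.col j, fun j => ?_, rfl⟩
    rw [segment_eq_image]
    exact ⟨t j, ht j, by simp⟩

theorem dotProduct_sum_smul_col (t : Fin m → ℝ) :
    η ⬝ᵥ ∑ j, t j • A.col j = ∑ j, t j * (η ᵥ* A) j := by
  rw [dotProduct_sum]
  exact Finset.sum_congr rfl fun j _ => by rw [dotProduct_smul, smul_eq_mul]; rfl

/-- The face of the zonotope in direction `η`. -/
def face (A : Matrix (Fin n) (Fin m) ℝ) (η : Fin n → ℝ) : Set (Fin n → ℝ) :=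
  {z ∈ zonotope A | ∀ w ∈ zonotope A, η ⬝ᵥ w ≤ η ⬝ᵥ z}

theorem isExposed_face : IsExposed ℝ (zonotope A) (face A η) := fun _ =>
  ⟨LinearMap.toContinuousLinearMap (dotProductEquiv ℝ (Fin n) η), by simp [face]⟩

theorem dotProduct_sub_eq_zero_of_mem_face {x y : Fin n → ℝ} (hx : x ∈ face A η)
    (hy : y ∈ face A η) : η ⬝ᵥ (x - y) = 0 := by
  rw [dotProduct_sub, sub_eq_zero]
  exact le_antisymm (hy.2 x hx.1) (hx.2 y hy.1)

theorem sum_smul_col_mem_face {t : Fin m → ℝ} (ht : ∀ j, t j ∈ Set.Icc (0 : ℝ) 1)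
    (hpos : ∀ j, 0 < (η ᵥ* A) j → t j = 1) (hneg : ∀ j, (η ᵥ* A) j < 0 → t j = 0) :
    ∑ j, t j • A.col j ∈ face A η := by
  refine ⟨mem_zonotope.2 ⟨t, ht, rfl⟩, fun w hw => ?_⟩
  obtain ⟨s, hs, rfl⟩ := mem_zonotope.1 hw
  rw [dotProduct_sum_smul_col, dotProduct_sum_smul_col]
  refine Finset.sum_le_sum fun j _ => ?_
  rcases lt_trichotomy ((η ᵥ* A) j) 0 with h | h | h
  · rw [hneg j h, zero_mul]
    exact mul_nonpos_of_nonneg_of_nonpos (hs j).1 h.le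
  · simp [h]
  · rw [hpos j h]
    exact mul_le_mul_of_nonneg_right (hs j).2 h.le

/-- A column orthogonal to `η` does not affect the value of `η`, so its coefficient can be switched
from 0 to 1 without leaving the face. -/
theorem exists_mem_face_and_add_col_mem_face (j : Fin m) (hj : (η ᵥ* A) j = 0) :
    ∃ p ∈ face A η, p + A.col j ∈ face A η := by
  classical
  let t : Fin m → ℝ := fun i => if 0 < (η ᵥ* A) i then 1 else 0
  have ht : ∀ i, t i ∈ Set.Icc (0 : ℝ) 1 := fun i => by
    by_cases h : 0 < (η ᵥ* A) i <;> simp [t, h]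
  refine ⟨∑ i, t i • A.col i, sum_smul_col_mem_face ht (fun i h => by simp [t, h])
    (fun i h => by simp [t, h.le]), ?_⟩
  have htj : t j = 0 := by simp [t, hj]
  have : ∑ i, t i • A.col i + A.col j = ∑ i, (Function.update t j 1) i • A.col i := by
    rw [← Finset.add_sum_erase _ _ (Finset.mem_univ j),
      ← Finset.add_sum_erase _ (fun i => Function.update t j 1 i • A.col i) (Finset.mem_univ j)]
    rw [Finset.sum_congr rfl fun i hi => by
      rw [← Function.update_of_ne (Finset.ne_of_mem_erase hi) (1 : ℝ) t]]
    simp [htj, add_comm]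
  rw [this]
  refine sum_smul_col_mem_face (fun i => ?_) (fun i h => ?_) (fun i h => ?_)
  · by_cases hi : i = j
    · subst hi; simp
    · simpa [hi] using ht i
  · have hi : i ≠ j := by rintro rfl; exact h.ne' hj
    simp [hi, t, h]
  · have hi : i ≠ j := by rintro rfl; exact h.ne hj
    simp [hi, t, h.le]

theorem nonempty_face : (face A η).Nonempty := by
  classical
  refine ⟨∑ i, (if 0 < (η ᵥ* A) i then (1 : ℝ) else 0) • A.col i,
    sum_smul_col_mem_face (fun i => ?_) (fun i h => by simp [h]) (fun i h => by simp [h.le])⟩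
  by_cases h : 0 < (η ᵥ* A) i <;> simp [h]

theorem vectorSpan_zonotope (hA : A.rank = n) : vectorSpan ℝ (zonotope A) = ⊤ := by
  rw [eq_top_iff, ← span_col_eq_top hA, Submodule.span_le]
  rintro _ ⟨j, rfl⟩
  have h0 : (0 : Fin n → ℝ) ∈ zonotope A := mem_zonotope.2 ⟨0, by simp, by simp⟩
  have hj : A.col j ∈ zonotope A := mem_zonotope.2 ⟨Pi.single j 1, fun i => by
    by_cases h : i = j
    · subst h; simp
    · simp [h], by simp [Pi.single_apply]⟩
  simpa using vsub_mem_vectorSpan ℝ hj h0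

theorem vectorSpan_face_le : vectorSpan ℝ (face A η) ≤
    LinearMap.ker (dotProductEquiv ℝ (Fin n) η) := by
  rw [vectorSpan, Submodule.span_le]
  rintro _ ⟨x, hx, y, hy, rfl⟩
  simpa using dotProduct_sub_eq_zero_of_mem_face hx hy

theorem orthSpan_le_vectorSpan_face : orthSpan A η ≤ vectorSpan ℝ (face A η) := by
  rw [orthSpan_le_iff]
  intro j hj
  obtain ⟨p, hp, hp'⟩ := exists_mem_face_and_add_col_mem_face j hj
  simpa using vsub_mem_vectorSpan ℝ hp' hp

theorem orthSpan_le_ker : orthSpan A η ≤ LinearMap.ker (dotProductEquiv ℝ (Fin n) η) :=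
  orthSpan_le_vectorSpan_face.trans vectorSpan_face_le

/-- If the columns orthogonal to `η` span a hyperplane, then `η` is a normal vector of a facet. -/
theorem isFacet_face (hA : A.rank = n) (hη : η ≠ 0) (h : finrank ℝ (orthSpan A η) + 1 = n) :
    IsFacet (zonotope A) (face A η) := by
  refine ⟨isExposed_face, nonempty_face, ?_⟩
  rw [vectorSpan_zonotope hA, finrank_top, finrank_fin_fun]
  -- The direction of the face lies between `orthSpan A η` and the hyperplane orthogonal to `η`,
  -- both of dimension `n - 1`.
  have h1 := Submodule.finrank_mono (vectorSpan_face_le (A := A) (η := η))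
  have h2 := Submodule.finrank_mono (orthSpan_le_vectorSpan_face (A := A) (η := η))
  have h3 := finrank_ker_dotProduct hη
  omega

theorem isNormal_face (hη : η ≠ 0) : IsNormal η (face A η) :=
  ⟨hη, fun _ hx _ hy => dotProduct_sub_eq_zero_of_mem_face hx hy⟩

end Facets

/-! ### Upper bound: power relations for all linear forms. -/

section PowerIdeal

open Polynomial in
/-- If the powers `(x - a y) ^ k a` vanish for finitely many reals `a`, and
`∑ (d + 1 - k a) > d`, then `y ^ d = 0`. -/
theorem pow_eq_zero_of_sub_smul_pow_eq_zero {R : Type*} [CommRing R] [Algebra ℝ R] (x y : R)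
    (d : ℕ) (T : Finset ℝ) (k e : ℝ → ℕ) (hke : ∀ a ∈ T, k a + e a = d + 1)
    (hsum : d < ∑ a ∈ T, e a) (h : ∀ a ∈ T, (x - a • y) ^ k a = 0) : y ^ d = 0 := by
  rcases subsingleton_or_nontrivial R with _ | _
  · exact Subsingleton.elim _ _
  let g : R[X] := (C x - C y * X) ^ d
  -- Expand `g` around `a`: the terms with at least `k a` factors `x - a y` vanish, and the others
  -- contain at least `d + 1 - k a = e a` factors `X - a`.
  have hdvd : ∀ a ∈ T, (X - C (algebraMap ℝ R a)) ^ e a ∣ g := fun a ha => by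
    have hg : g = (C (x - a • y) + (-C y) * (X - C (algebraMap ℝ R a))) ^ d := by
      simp only [g]
      congr 1
      rw [Algebra.smul_def, C_sub, C_mul]
      ring
    rw [hg, add_pow]
    refine Finset.dvd_sum fun i _ => ?_
    by_cases hi : k a ≤ i
    · rw [← C_pow, pow_eq_zero_of_le hi (h a ha)]
      simp
    · have := hke a ha
      rw [mul_pow]
      exact ((pow_dvd_pow _ (by omega)).mul_left _).mul_left _ |>.mul_right _
  have hprod : ∏ a ∈ T, (X - C (algebraMap ℝ R a)) ^ e a ∣ g := by
    refine Finset.prod_dvd_of_coprime (fun a _ b _ hab => ?_) hdvd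
    -- Distinct real numbers differ by a unit of `R`, so coprimality holds although `R` need not be
    -- a domain.
    refine (isCoprime_X_sub_C_of_isUnit_sub ?_).pow
    rw [← map_sub]
    exact (sub_ne_zero.2 hab).isUnit.map _
  have hmonic : (∏ a ∈ T, (X - C (algebraMap ℝ R a)) ^ e a).Monic :=
    monic_prod_of_monic _ _ fun a _ => (monic_X_sub_C _).pow _
  have hdeg : (∏ a ∈ T, (X - C (algebraMap ℝ R a)) ^ e a).natDegree = ∑ a ∈ T, e a := by
    rw [natDegree_prod_of_monic _ _ fun a _ => (monic_X_sub_C _).pow _]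
    refine Finset.sum_congr rfl fun a _ => ?_
    rw [(monic_X_sub_C _).natDegree_pow, natDegree_X_sub_C, mul_one]
  have hlin : (C x - C y * X).natDegree ≤ 1 := by
    refine (natDegree_sub_le _ _).trans ?_
    simpa using (natDegree_C_mul_le y X).trans natDegree_X_le
  have hgdeg : g.natDegree ≤ d := by
    simpa using natDegree_pow_le_of_le d hlin
  have hg0 : g = 0 := by
    by_contra hg
    exact hmonic.not_dvd_of_natDegree_lt hg (by omega) hprod
  -- The coefficient of degree `d` is `y ^ d` up to sign, and `g = 0`.
  have hc : g.coeff d = (-y) ^ d := by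
    have := coeff_pow_of_natDegree_le (m := d) hlin
    rw [mul_one] at this
    simp only [g, this]
    simp [coeff_C]
  rw [hg0, coeff_zero, neg_pow] at hc
  have : IsUnit ((-1 : R) ^ d) := (isUnit_one.neg).pow d
  exact (this.mul_right_eq_zero).1 hc.symm

variable {n m : ℕ} {A : Matrix (Fin n) (Fin m) ℝ} {η : Fin n → ℝ}

/-- The linear forms, as a linear function of the coefficient vector. -/
noncomputable def linearFormHom (n : ℕ) : (Fin n → ℝ) →ₗ[ℝ] MvPolynomial (Fin n) ℝ :=
  Fintype.linearCombination ℝ MvPolynomial.X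

theorem linearForm_eq (η : Fin n → ℝ) : linearForm η = linearFormHom n η := by
  simp [linearForm, linearFormHom, Fintype.linearCombination_apply, MvPolynomial.smul_eq_C_mul]

theorem linearForm_single (i : Fin n) : linearForm (Pi.single i 1) = MvPolynomial.X i := by
  rw [linearForm_eq, linearFormHom, Fintype.linearCombination_apply_single, one_smul]

theorem mult_eq_card (A : Matrix (Fin n) (Fin m) ℝ) (η : Fin n → ℝ) :
    mult A η = (Finset.univ.filter fun j => (η ᵥ* A) j ≠ 0).card := rfl

/-- The annihilator of `F` has dimension at least 2, so it is not contained in a line. -/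
theorem exists_orthogonal_not_mem_span (F : Submodule ℝ (Fin n → ℝ)) (hF : finrank ℝ F + 2 ≤ n)
    (η : Fin n → ℝ) : ∃ u, (∀ v ∈ F, u ⬝ᵥ v = 0) ∧ u ∉ Submodule.span ℝ {η} := by
  let Φ : (Fin n → ℝ) →ₗ[ℝ] Dual ℝ F :=
    (Submodule.dualRestrict F).comp (dotProductEquiv ℝ (Fin n)).toLinearMap
  have h1 := LinearMap.finrank_range_add_finrank_ker Φ
  have h2 : finrank ℝ (LinearMap.range Φ) ≤ finrank ℝ F := by
    rw [← Subspace.dual_finrank_eq (K := ℝ) (V := F)]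
    exact Submodule.finrank_le _
  rw [finrank_fin_fun] at h1
  have h3 : ¬ LinearMap.ker Φ ≤ Submodule.span ℝ {η} := fun hle => by
    have h4 := Submodule.finrank_mono hle
    have h5 := finrank_span_le_card (R := ℝ) ({η} : Set (Fin n → ℝ))
    simp at h5
    omega
  obtain ⟨u, hu, hu'⟩ := SetLike.not_le_iff_exists.1 h3
  refine ⟨u, fun v hv => ?_, hu'⟩
  have := LinearMap.congr_fun (LinearMap.mem_ker.1 hu) ⟨v, hv⟩
  simpa [Φ] using this

theorem linearForm_pow_mem_of_facet (hA : A.rank = n) (hη : η ≠ 0)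
    (h : finrank ℝ (orthSpan A η) + 1 = n) :
    linearForm η ^ (mult A η + 1) ∈ externalIdeal A :=
  Ideal.subset_span ⟨_, η, isFacet_face hA hη h, isNormal_face hη, rfl⟩

/-- The external ideal contains the powers `(η · x) ^ (m(η) + 1)` for all `η`, not only those for
normal vectors of facets. -/
theorem linearForm_pow_mem (hA : A.rank = n) (η : Fin n → ℝ) :
    linearForm η ^ (mult A η + 1) ∈ externalIdeal A := by
  classical
  -- Induction on the codimension of the span of the columns orthogonal to `η`; codimension 1 is the
  -- facet case.
  induction hN : n - finrank ℝ (orthSpan A η) using Nat.strong_induction_on generalizing η with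
  | _ N ih =>
  by_cases hη : η = 0
  · subst hη
    rw [linearForm_eq, map_zero, zero_pow (Nat.succ_ne_zero _)]
    exact zero_mem _
  have hle := Submodule.finrank_mono (orthSpan_le_ker (A := A) (η := η))
  have hker := finrank_ker_dotProduct hη
  by_cases hfac : finrank ℝ (orthSpan A η) + 1 = n
  · exact linearForm_pow_mem_of_facet hA hη hfac
  obtain ⟨u, hu, huη⟩ := exists_orthogonal_not_mem_span (orthSpan A η) (by omega) η
  have huA : ∀ j, (η ᵥ* A) j = 0 → (u ᵥ* A) j = 0 := fun j hj => hu _ (col_mem_orthSpan hj)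
  -- In the pencil `u - c η`, the columns outside `S` stay orthogonal, and a column `j ∈ S` becomes
  -- orthogonal exactly at `c = a j`. At these values `orthSpan` grows strictly, so the induction
  -- hypothesis applies.
  let S : Finset (Fin m) := Finset.univ.filter fun j => (η ᵥ* A) j ≠ 0
  let a : Fin m → ℝ := fun j => (u ᵥ* A) j / (η ᵥ* A) j
  have hval : ∀ (c : ℝ) j, ((u - c • η) ᵥ* A) j = (u ᵥ* A) j - c * (η ᵥ* A) j := fun c j => by
    rw [sub_vecMul, smul_vecMul]; rfl
  have hzero : ∀ (c : ℝ) j, j ∈ S → (((u - c • η) ᵥ* A) j = 0 ↔ a j = c) := fun c j hj => by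
    have hj' : (η ᵥ* A) j ≠ 0 := by simpa [S] using hj
    rw [hval, sub_eq_zero, div_eq_iff hj']
  have hzero' : ∀ (c : ℝ) j, j ∉ S → ((u - c • η) ᵥ* A) j = 0 := fun c j hj => by
    have hj' : (η ᵥ* A) j = 0 := by simpa [S] using hj
    rw [hval, huA j hj', hj']; simp
  have hne : ∀ c : ℝ, ∃ j ∈ S, a j ≠ c := fun c => by
    by_contra! hc
    have : u - c • η = 0 := (vecMul_eq_zero_iff hA).1 <| funext fun j => by
      by_cases hj : j ∈ S
      · exact (hzero c j hj).2 (hc j hj)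
      · exact hzero' c j hj
    exact huη (Submodule.mem_span_singleton.2 ⟨c, (sub_eq_zero.1 this).symm⟩)
  let s : ℝ → ℕ := fun c => (S.filter fun j => a j = c).card
  have hmult : ∀ c, mult A (u - c • η) + s c = S.card := fun c => by
    rw [mult_eq_card, ← Finset.card_filter_add_card_filter_not (s := S) (fun j => a j = c), add_comm]
    congr 2
    ext j
    by_cases hj : j ∈ S
    · simp [hj, hzero c j hj]
    · simp [hj, hzero' c j hj]
  have hsum : ∑ c ∈ S.image a, s c = S.card :=
    (Finset.card_eq_sum_card_fiberwise fun j hj => Finset.mem_image_of_mem a hj).symm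
  -- A single ratio would make `u` a multiple of `η`.
  have htwo : 2 ≤ (S.image a).card := by
    obtain ⟨j, hj, -⟩ := hne 0
    obtain ⟨i, hi, hij⟩ := hne (a j)
    exact Finset.one_lt_card.2 ⟨a i, Finset.mem_image_of_mem a hi, a j,
      Finset.mem_image_of_mem a hj, hij⟩
  -- With `d = |S| + 1`, the exponents `e c = s c + 1` sum to `|S|` plus the number of ratios, which
  -- is at least `|S| + 2 > d`.
  have key := pow_eq_zero_of_sub_smul_pow_eq_zero
    (Ideal.Quotient.mkₐ ℝ (externalIdeal A) (linearForm u))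
    (Ideal.Quotient.mkₐ ℝ (externalIdeal A) (linearForm η)) (S.card + 1) (S.image a)
    (fun c => mult A (u - c • η) + 1) (fun c => s c + 1)
    (fun c _ => by have := hmult c; omega)
    (by rw [Finset.sum_add_distrib, hsum, Finset.sum_const, smul_eq_mul, mul_one]; omega)
    (fun c hc => by
      rw [← map_smul, ← map_sub, ← map_pow, linearForm_eq, linearForm_eq, ← map_smul, ← map_sub,
        ← linearForm_eq]
      refine Ideal.Quotient.eq_zero_iff_mem.2 (ih _ ?_ _ rfl)
      obtain ⟨j, hj, rfl⟩ := Finset.mem_image.1 hc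
      have hlt : orthSpan A η < orthSpan A (u - a j • η) := by
        refine lt_of_le_of_ne (orthSpan_le_iff.2 fun i hi => col_mem_orthSpan ?_) fun heq => ?_
        · exact hzero' _ _ (by simpa [S] using hi)
        · have hmem : A.col j ∈ orthSpan A η := by
            rw [heq]
            exact col_mem_orthSpan ((hzero _ j hj).2 rfl)
          have hj' : (η ᵥ* A) j ≠ 0 := by simpa [S] using hj
          exact hj' (dotProduct_eq_zero_of_mem_orthSpan hmem)
      have := Submodule.finrank_lt_finrank_of_lt hlt
      have := Submodule.finrank_le (orthSpan A (u - a j • η))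
      rw [finrank_fin_fun] at this
      omega)
  rw [← map_pow] at key
  exact Ideal.Quotient.eq_zero_iff_mem.1 key

end PowerIdeal

/-! ### Lower bound: the square-free algebra. -/

section SquareFree

theorem add_pow_succ_of_sq_eq_zero {R : Type*} [CommRing R] {x : R} (hx : x ^ 2 = 0) (a : R)
    (k : ℕ) : (x + a) ^ (k + 1) = a ^ (k + 1) + (k + 1) * (a ^ k * x) := by
  induction k with
  | zero => simp [add_comm]
  | succ k ih =>
    rw [pow_succ, ih]
    push_cast
    linear_combination ((k : R) + 1) * a ^ k * hx

theorem sum_pow_card_of_sq_eq_zero {R ι : Type*} [CommRing R] {x : ι → R}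
    (hx : ∀ j, x j ^ 2 = 0) (S : Finset ι) :
    (∑ j ∈ S, x j) ^ (S.card + 1) = 0 ∧
      (∑ j ∈ S, x j) ^ S.card = (S.card.factorial : R) * ∏ j ∈ S, x j := by
  classical
  induction S using Finset.induction_on with
  | empty => simp
  | insert j S hj ih =>
    rw [Finset.sum_insert hj, Finset.prod_insert hj, Finset.card_insert_of_notMem hj,
      add_pow_succ_of_sq_eq_zero (hx j), add_pow_succ_of_sq_eq_zero (hx j)]
    refine ⟨by rw [pow_succ, ih.1]; simp, ?_⟩
    rw [ih.1, ih.2, Nat.factorial_succ]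
    push_cast
    ring

/-- Used to discard higher-order terms: they do not affect the lowest-degree part of a power. -/
theorem add_pow_sub_pow_mem {R : Type*} [CommRing R] {J : Ideal R} {p q : R} (hp : p ∈ J)
    (hq : q ∈ J ^ 2) (k : ℕ) : (p + q) ^ k - p ^ k ∈ J ^ (k + 1) := by
  induction k with
  | zero => simp
  | succ k ih =>
    have : (p + q) ^ (k + 1) - p ^ (k + 1) = ((p + q) ^ k - p ^ k) * (p + q) + p ^ k * q := by ring
    rw [this]
    refine add_mem ?_ ?_
    · rw [pow_succ]
      exact Ideal.mul_mem_mul ih (add_mem hp (Ideal.pow_le_self two_ne_zero hq))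
    · rw [show k + 1 + 1 = k + 2 from rfl, pow_add]
      exact Ideal.mul_mem_mul (Ideal.pow_mem_pow hp k) hq

open MvPolynomial

/-- The ideal generated by the squares of the variables. -/
noncomputable def squaresIdeal (m : ℕ) : Ideal (MvPolynomial (Fin m) ℝ) :=
  Ideal.span (Set.range fun j => X j ^ 2)

/-- The ideal is monomial, and a square-free monomial is divisible by no `X j ^ 2`. -/
theorem coeff_eq_zero_of_mem_squaresIdeal {m : ℕ} {p : MvPolynomial (Fin m) ℝ}
    (hp : p ∈ squaresIdeal m) (S : Finset (Fin m)) :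
    p.coeff (∑ j ∈ S, Finsupp.single j 1) = 0 := by
  classical
  have hK : squaresIdeal m = Ideal.span ((fun s => monomial s (1 : ℝ)) ''
      Set.range fun j => Finsupp.single j 2) := by
    rw [squaresIdeal, ← Set.range_comp]
    congr 2
    ext1 j
    simp [X_pow_eq_monomial]
  rw [hK, mem_ideal_span_monomial_image] at hp
  by_contra h
  obtain ⟨_, ⟨j, rfl⟩, hj⟩ := hp _ (mem_support_iff.2 h)
  have := hj j
  rw [Finsupp.finsetSum_apply] at this
  simp only [Finsupp.single_apply, if_true, Finset.sum_ite_eq'] at this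
  split_ifs at this <;> omega

variable {n m : ℕ} {A : Matrix (Fin n) (Fin m) ℝ}

/-- The substitution `x_i ↦ ∑_j a_{ij} φ_j`. -/
noncomputable def columnSubst (A : Matrix (Fin n) (Fin m) ℝ) :
    MvPolynomial (Fin n) ℝ →ₐ[ℝ] MvPolynomial (Fin m) ℝ :=
  aeval fun i => linearForm (A i)

theorem aeval_linearForm {R : Type*} [CommRing R] [Algebra ℝ R] (f : Fin n → R) (η : Fin n → ℝ) :
    aeval f (linearForm η) = ∑ i, η i • f i := by
  simp [linearForm, Algebra.smul_def]

theorem columnSubst_linearForm (η : Fin n → ℝ) :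
    columnSubst A (linearForm η) = linearForm (η ᵥ* A) := by
  rw [columnSubst, aeval_linearForm, vecMul_eq_sum, linearForm_eq, map_sum]
  simp only [linearForm_eq, map_smul]

theorem linearForm_mem_idealOfVars (η : Fin n → ℝ) : linearForm η ∈ idealOfVars (Fin n) ℝ :=
  sum_mem fun i _ => Ideal.mul_mem_left _ _ (Ideal.subset_span ⟨i, rfl⟩)

theorem columnSubst_mem_idealOfVars_pow {q : MvPolynomial (Fin n) ℝ} {k : ℕ}
    (hq : q ∈ idealOfVars (Fin n) ℝ ^ k) : columnSubst A q ∈ idealOfVars (Fin m) ℝ ^ k := by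
  have hle : (idealOfVars (Fin n) ℝ).map (columnSubst A) ≤ idealOfVars (Fin m) ℝ := by
    rw [Ideal.map_span, Ideal.span_le]
    rintro _ ⟨_, ⟨i, rfl⟩, rfl⟩
    simpa [columnSubst] using linearForm_mem_idealOfVars (A i)
  have := Ideal.mem_map_of_mem (columnSubst A) hq
  rw [Ideal.map_pow] at this
  exact Ideal.pow_right_mono hle k this

theorem linearForm_pow_sub_mem_squaresIdeal (c : Fin m → ℝ) :
    let S := Finset.univ.filter fun j => c j ≠ 0
    linearForm c ^ (S.card + 1) ∈ squaresIdeal m ∧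
      linearForm c ^ S.card - (S.card.factorial : MvPolynomial (Fin m) ℝ) *
        ∏ j ∈ S, (C (c j) * X j) ∈ squaresIdeal m := by
  intro S
  have hlin : linearForm c = ∑ j ∈ S, C (c j) * X j := by
    rw [linearForm, Finset.sum_filter_of_ne]
    rintro j - hj h
    simp [h] at hj
  have hsq : ∀ j, Ideal.Quotient.mk (squaresIdeal m) (C (c j) * X j) ^ 2 = 0 := fun j => by
    rw [← map_pow, mul_pow]
    exact Ideal.Quotient.eq_zero_iff_mem.2 (Ideal.mul_mem_left _ _ (Ideal.subset_span ⟨j, rfl⟩))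
  obtain ⟨h1, h2⟩ := sum_pow_card_of_sq_eq_zero hsq S
  rw [← map_sum, ← hlin, ← map_pow] at h1 h2
  refine ⟨Ideal.Quotient.eq_zero_iff_mem.1 h1, Ideal.Quotient.eq_zero_iff_mem.1 ?_⟩
  rw [map_sub, h2, map_mul, map_prod, map_natCast, sub_self]

theorem columnSubst_mem_squaresIdeal {p : MvPolynomial (Fin n) ℝ} (hp : p ∈ externalIdeal A) :
    columnSubst A p ∈ squaresIdeal m := by
  suffices externalIdeal A ≤ (squaresIdeal m).comap (columnSubst A) from this hp
  rw [externalIdeal, Ideal.span_le]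
  rintro _ ⟨H, η, -, -, rfl⟩
  rw [SetLike.mem_coe, Ideal.mem_comap, map_pow, columnSubst_linearForm]
  exact (linearForm_pow_sub_mem_squaresIdeal _).1

/-- The order of nilpotency of an element of the external algebra with linear part `η` exceeds the
multiplicity of `η`. -/
theorem mult_lt_of_pow_mem {η : Fin n → ℝ} {q : MvPolynomial (Fin n) ℝ}
    (hq : q ∈ idealOfVars (Fin n) ℝ ^ 2) {k : ℕ}
    (h : (linearForm η + q) ^ k ∈ externalIdeal A) : mult A η < k := by
  by_contra! hk
  have hM := columnSubst_mem_squaresIdeal (Ideal.pow_mem_of_pow_mem _ h hk)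
  rw [map_pow, map_add, columnSubst_linearForm] at hM
  have hdiff := add_pow_sub_pow_mem (linearForm_mem_idealOfVars (η ᵥ* A))
    (columnSubst_mem_idealOfVars_pow (A := A) hq) (mult A η)
  have hS := (linearForm_pow_sub_mem_squaresIdeal (η ᵥ* A)).2
  rw [← mult_eq_card] at hS
  set S := Finset.univ.filter fun j => (η ᵥ* A) j ≠ 0 with hSdef
  -- Compare coefficients of the square-free monomial on the support `S` of `η A`. Its degree is
  -- `mult A η`, too low to see `q`, so the coefficient is `(mult A η)! ∏ (η A)_j ≠ 0`, whereas `hM`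
  -- makes it zero.
  have h1 := coeff_eq_zero_of_mem_squaresIdeal hM S
  have h2 := coeff_eq_zero_of_mem_squaresIdeal hS S
  have h3 := (mem_pow_idealOfVars_iff' _ _).1 hdiff (∑ j ∈ S, Finsupp.single j 1) (by
    rw [map_sum]
    simp only [Finsupp.degree_single, Finset.sum_const, smul_eq_mul, mul_one]
    exact Nat.lt_succ_self _)
  have h4 : ((mult A η).factorial : MvPolynomial (Fin m) ℝ) * ∏ j ∈ S, (C ((η ᵥ* A) j) * X j) =
      monomial (∑ j ∈ S, Finsupp.single j 1)
        ((mult A η).factorial * ∏ j ∈ S, (η ᵥ* A) j) := by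
    rw [Finset.prod_mul_distrib, ← map_prod, ← mul_one ((_ : ℝ) * _), ← C_mul_monomial,
      monomial_sum_one, C_mul, map_natCast, mul_assoc]
    rfl
  rw [h4, coeff_sub, coeff_monomial, if_pos rfl] at h2
  rw [coeff_sub] at h3
  have h5 : ((mult A η).factorial : ℝ) * ∏ j ∈ S, (η ᵥ* A) j ≠ 0 :=
    mul_ne_zero (by exact_mod_cast Nat.factorial_ne_zero _)
      (Finset.prod_ne_zero_iff.2 fun j hj => by simpa [S] using hj)
  apply h5
  linarith

end SquareFree

/-! ### The linear part of an algebra homomorphism. -/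

section LinearPart

variable {n m : ℕ} {A : Matrix (Fin n) (Fin m) ℝ}

/-- The algebra homomorphism which truncates a polynomial after degree one. -/
noncomputable def truncation (n : ℕ) :
    MvPolynomial (Fin n) ℝ →ₐ[ℝ] TrivSqZeroExt ℝ (Fin n → ℝ) :=
  MvPolynomial.aeval fun i => TrivSqZeroExt.inr (Pi.single i 1)

theorem truncation_linearForm (η : Fin n → ℝ) :
    truncation n (linearForm η) = TrivSqZeroExt.inr η := by
  rw [truncation, aeval_linearForm]
  simp only [← TrivSqZeroExt.inr_smul]
  rw [← TrivSqZeroExt.inr_sum, ← pi_eq_sum_univ']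

theorem truncation_X (i : Fin n) :
    truncation n (MvPolynomial.X i) = TrivSqZeroExt.inr (Pi.single i 1) := by
  rw [truncation, MvPolynomial.aeval_X]

theorem one_le_mult (hA : A.rank = n) {η : Fin n → ℝ} (hη : η ≠ 0) : 1 ≤ mult A η := by
  rw [Nat.one_le_iff_ne_zero]
  exact fun h => hη ((vecMul_eq_zero_iff hA).1 (hammingNorm_eq_zero.1 h))

/-- Full rank gives `mult A η ≥ 1` for `η ≠ 0`, so every generator is at least a square of a linear
form. -/
theorem truncation_eq_zero (hA : A.rank = n) {p : MvPolynomial (Fin n) ℝ}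
    (hp : p ∈ externalIdeal A) : truncation n p = 0 := by
  suffices externalIdeal A ≤ RingHom.ker (truncation n) from this hp
  rw [externalIdeal, Ideal.span_le]
  rintro _ ⟨H, η, -, hη, rfl⟩
  rw [SetLike.mem_coe, RingHom.mem_ker, map_pow, truncation_linearForm]
  refine pow_eq_zero_of_le (Nat.succ_le_succ (one_le_mult hA hη.1)) ?_
  rw [pow_two, TrivSqZeroExt.inr_mul_inr]

/-- The truncation of the external zonotopal algebra after degree one. -/
noncomputable def algebraTruncation (hA : A.rank = n) :
    ExternalAlgebra A →ₐ[ℝ] TrivSqZeroExt ℝ (Fin n → ℝ) :=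
  Ideal.Quotient.liftₐ (externalIdeal A) (truncation n) fun _ hp => truncation_eq_zero hA hp

theorem algebraTruncation_mk (hA : A.rank = n) (p : MvPolynomial (Fin n) ℝ) :
    algebraTruncation hA (Ideal.Quotient.mkₐ ℝ (externalIdeal A) p) = truncation n p := rfl

theorem sub_truncation_mem (p : MvPolynomial (Fin n) ℝ) :
    p - MvPolynomial.C (truncation n p).fst - linearForm (truncation n p).snd ∈
      MvPolynomial.idealOfVars (Fin n) ℝ ^ 2 := by
  induction p using MvPolynomial.induction_on with
  | C a =>
    have : truncation n (MvPolynomial.C a) = TrivSqZeroExt.inl a := by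
      rw [truncation, MvPolynomial.aeval_C]; rfl
    rw [this]
    simp [linearForm_eq]
  | add p q hp hq =>
    convert add_mem hp hq using 1
    simp only [map_add, TrivSqZeroExt.fst_add, TrivSqZeroExt.snd_add, linearForm_eq]
    ring
  | mul_X p i hp =>
    have hX : (MvPolynomial.X i : MvPolynomial (Fin n) ℝ) ∈ MvPolynomial.idealOfVars (Fin n) ℝ :=
      Ideal.subset_span ⟨i, rfl⟩
    have h := add_mem (Ideal.mul_mem_right (MvPolynomial.X i) _ hp)
      (by rw [pow_two]; exact Ideal.mul_mem_mul (linearForm_mem_idealOfVars (truncation n p).snd) hX)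
    convert h using 1
    rw [map_mul, truncation_X, TrivSqZeroExt.fst_mul, TrivSqZeroExt.snd_mul,
      TrivSqZeroExt.fst_inr, TrivSqZeroExt.snd_inr]
    simp only [mul_zero, map_zero, MulOpposite.op_zero, zero_smul, add_zero, linearForm_eq,
      map_smul]
    rw [← linearForm_eq, linearForm_single, MvPolynomial.smul_eq_C_mul]
    ring

theorem isNilpotent_mk_linearForm (hA : A.rank = n) (η : Fin n → ℝ) :
    IsNilpotent (Ideal.Quotient.mkₐ ℝ (externalIdeal A) (linearForm η)) :=
  ⟨mult A η + 1, by
    rw [← map_pow]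
    exact Ideal.Quotient.eq_zero_iff_mem.2 (linearForm_pow_mem hA η)⟩

variable {n' m' : ℕ} {A' : Matrix (Fin n') (Fin m') ℝ}

/-- The linear part of a homomorphism between external zonotopal algebras. -/
noncomputable def linearPart (hA' : A'.rank = n')
    (e : ExternalAlgebra A →ₐ[ℝ] ExternalAlgebra A') : (Fin n → ℝ) →ₗ[ℝ] (Fin n' → ℝ) :=
  (TrivSqZeroExt.sndHom ℝ (Fin n' → ℝ)) ∘ₗ (algebraTruncation hA').toLinearMap ∘ₗ e.toLinearMap ∘ₗ
    (Ideal.Quotient.mkₐ ℝ (externalIdeal A)).toLinearMap ∘ₗ linearFormHom n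

theorem linearPart_apply (hA' : A'.rank = n') (e : ExternalAlgebra A →ₐ[ℝ] ExternalAlgebra A')
    (η : Fin n → ℝ) : linearPart hA' e η =
      (algebraTruncation hA' (e (Ideal.Quotient.mkₐ ℝ (externalIdeal A) (linearForm η)))).snd := by
  rw [linearForm_eq]; rfl

/-- The constant term is the image of a nilpotent element in `ℝ`. This is what makes ungraded
homomorphisms tractable. -/
theorem fst_algebraTruncation (hA : A.rank = n) (hA' : A'.rank = n')
    (e : ExternalAlgebra A →ₐ[ℝ] ExternalAlgebra A') (η : Fin n → ℝ) :
    (algebraTruncation hA'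
      (e (Ideal.Quotient.mkₐ ℝ (externalIdeal A) (linearForm η)))).fst = 0 := by
  have h := (((isNilpotent_mk_linearForm hA η).map e).map (algebraTruncation hA')).map
    (TrivSqZeroExt.fstHom ℝ ℝ (Fin n' → ℝ))
  exact h.eq_zero

theorem algebraTruncation_comp (hA : A.rank = n) (hA' : A'.rank = n')
    (e : ExternalAlgebra A →ₐ[ℝ] ExternalAlgebra A') :
    (algebraTruncation hA').comp e =
      (TrivSqZeroExt.map (linearPart hA' e)).comp (algebraTruncation hA) := by
  refine Ideal.Quotient.algHom_ext _ (MvPolynomial.algHom_ext fun i => ?_)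
  change algebraTruncation hA' (e (Ideal.Quotient.mkₐ ℝ _ (MvPolynomial.X i))) =
    TrivSqZeroExt.map (linearPart hA' e)
      (algebraTruncation hA (Ideal.Quotient.mkₐ ℝ _ (MvPolynomial.X i)))
  rw [algebraTruncation_mk, truncation_X, TrivSqZeroExt.map_inr, ← linearForm_single]
  ext1
  · rw [fst_algebraTruncation hA, TrivSqZeroExt.fst_inr]
  · rw [TrivSqZeroExt.snd_inr, linearPart_apply]

theorem linearPart_comp_eq_id (hA : A.rank = n) (hA' : A'.rank = n')
    (e : ExternalAlgebra A →ₐ[ℝ] ExternalAlgebra A')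
    (f : ExternalAlgebra A' →ₐ[ℝ] ExternalAlgebra A) (hfe : f.comp e = AlgHom.id ℝ _) :
    linearPart hA f ∘ₗ linearPart hA' e = LinearMap.id := by
  refine LinearMap.ext fun η => ?_
  have h1 := DFunLike.congr_fun (algebraTruncation_comp hA' hA f)
    (e (Ideal.Quotient.mkₐ ℝ (externalIdeal A) (linearForm η)))
  have h2 := DFunLike.congr_fun hfe (Ideal.Quotient.mkₐ ℝ (externalIdeal A) (linearForm η))
  simp only [AlgHom.comp_apply, AlgHom.id_apply] at h1 h2
  rw [h2, algebraTruncation_mk, truncation_linearForm] at h1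
  have h3 := congrArg TrivSqZeroExt.snd h1
  rw [TrivSqZeroExt.snd_inr, TrivSqZeroExt.snd_map, ← linearPart_apply] at h3
  exact h3.symm

/-- The image of `η · x` dies at the power `mult A η + 1`, while its linear part forces order
greater than the multiplicity of that part. -/
theorem mult_linearPart_le (hA : A.rank = n) (hA' : A'.rank = n')
    (e : ExternalAlgebra A →ₐ[ℝ] ExternalAlgebra A') (η : Fin n → ℝ) :
    mult A' (linearPart hA' e η) ≤ mult A η := by
  obtain ⟨g, hg⟩ := Ideal.Quotient.mkₐ_surjective ℝ (externalIdeal A')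
    (e (Ideal.Quotient.mkₐ ℝ (externalIdeal A) (linearForm η)))
  have h0 := fst_algebraTruncation hA hA' e η
  have h1 := linearPart_apply hA' e η
  rw [← hg, algebraTruncation_mk] at h0 h1
  have h2 := sub_truncation_mem g
  rw [h0, ← h1, map_zero, sub_zero] at h2
  refine Nat.lt_succ_iff.1 (mult_lt_of_pow_mem h2 ?_)
  rw [add_sub_cancel, ← Ideal.Quotient.eq_zero_iff_mem]
  change Ideal.Quotient.mkₐ ℝ (externalIdeal A') _ = 0
  rw [map_pow, hg, ← map_pow, ← map_pow]
  rw [show Ideal.Quotient.mkₐ ℝ (externalIdeal A) (linearForm η ^ (mult A η).succ) = 0 from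
    Ideal.Quotient.eq_zero_iff_mem.2 (linearForm_pow_mem hA η), map_zero]

/-- A linear isomorphism of the spaces of linear forms which preserves the multiplicities. -/
def MultIsomorphic (A : Matrix (Fin n) (Fin m) ℝ) (A' : Matrix (Fin n') (Fin m') ℝ) : Prop :=
  ∃ L : (Fin n → ℝ) ≃ₗ[ℝ] (Fin n' → ℝ), ∀ η, mult A' (L η) = mult A η

theorem AlgIsomorphic.multIsomorphic (hA : A.rank = n) (hA' : A'.rank = n')
    (h : AlgIsomorphic A A') : MultIsomorphic A A' := by
  obtain ⟨e⟩ := h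
  have h1 := linearPart_comp_eq_id hA hA' (e : ExternalAlgebra A →ₐ[ℝ] ExternalAlgebra A')
    (e.symm : ExternalAlgebra A' →ₐ[ℝ] ExternalAlgebra A) (by ext x; simp)
  have h2 := linearPart_comp_eq_id hA' hA
    (e.symm : ExternalAlgebra A' →ₐ[ℝ] ExternalAlgebra A)
    (e : ExternalAlgebra A →ₐ[ℝ] ExternalAlgebra A') (by ext x; simp)
  refine ⟨LinearEquiv.ofLinearMap _ _ h2 h1, fun η => le_antisymm ?_ ?_⟩
  · exact mult_linearPart_le hA hA' _ η
  · have h3 := mult_linearPart_le hA' hA (e.symm : ExternalAlgebra A' →ₐ[ℝ] ExternalAlgebra A)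
      (linearPart hA' (e : ExternalAlgebra A →ₐ[ℝ] ExternalAlgebra A') η)
    rwa [← LinearMap.comp_apply, h1] at h3

end LinearPart

/-! ### Graded isomorphisms from multiplicity-preserving maps. -/

section Substitution

variable {n m n' m' : ℕ} {A : Matrix (Fin n) (Fin m) ℝ} {A' : Matrix (Fin n') (Fin m') ℝ}

theorem MultIsomorphic.symm (h : MultIsomorphic A A') : MultIsomorphic A' A := by
  obtain ⟨L, hL⟩ := h
  exact ⟨L.symm, fun η => by rw [← hL, L.apply_symm_apply]⟩

/-- The substitution `x_i ↦ L(e_i) · x`. -/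
noncomputable def linearSubst (L : (Fin n → ℝ) →ₗ[ℝ] (Fin n' → ℝ)) :
    MvPolynomial (Fin n) ℝ →ₐ[ℝ] MvPolynomial (Fin n') ℝ :=
  MvPolynomial.aeval fun i => linearForm (L (Pi.single i 1))

theorem linearSubst_linearForm (L : (Fin n → ℝ) →ₗ[ℝ] (Fin n' → ℝ)) (η : Fin n → ℝ) :
    linearSubst L (linearForm η) = linearForm (L η) := by
  rw [linearSubst, aeval_linearForm]
  conv_rhs => rw [pi_eq_sum_univ' η]
  simp only [linearForm_eq, map_sum, map_smul]

/-- `L` is not known to send facet normals to facet normals, so the relations for arbitrary forms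
are needed in the target. -/
theorem linearSubst_mem (hA' : A'.rank = n') {L : (Fin n → ℝ) →ₗ[ℝ] (Fin n' → ℝ)}
    (hL : ∀ η, mult A' (L η) = mult A η) {p : MvPolynomial (Fin n) ℝ}
    (hp : p ∈ externalIdeal A) : linearSubst L p ∈ externalIdeal A' := by
  suffices externalIdeal A ≤ (externalIdeal A').comap (linearSubst L) from this hp
  rw [externalIdeal, Ideal.span_le]
  rintro _ ⟨H, η, -, -, rfl⟩
  rw [SetLike.mem_coe, Ideal.mem_comap, map_pow, linearSubst_linearForm, ← hL]
  exact linearForm_pow_mem hA' _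

/-- The homomorphism of external zonotopal algebras induced by a linear substitution. -/
noncomputable def algebraSubst (hA' : A'.rank = n') {L : (Fin n → ℝ) →ₗ[ℝ] (Fin n' → ℝ)}
    (hL : ∀ η, mult A' (L η) = mult A η) : ExternalAlgebra A →ₐ[ℝ] ExternalAlgebra A' :=
  Ideal.quotientMapₐ (externalIdeal A') (linearSubst L) fun _ hp => linearSubst_mem hA' hL hp

theorem algebraSubst_mk (hA' : A'.rank = n') {L : (Fin n → ℝ) →ₗ[ℝ] (Fin n' → ℝ)}
    (hL : ∀ η, mult A' (L η) = mult A η) (p : MvPolynomial (Fin n) ℝ) :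
    algebraSubst hA' hL (Ideal.Quotient.mkₐ ℝ (externalIdeal A) p) =
      Ideal.Quotient.mkₐ ℝ (externalIdeal A') (linearSubst L p) := rfl

theorem algebraSubst_comp (hA : A.rank = n) (hA' : A'.rank = n')
    {L : (Fin n → ℝ) →ₗ[ℝ] (Fin n' → ℝ)} (hL : ∀ η, mult A' (L η) = mult A η)
    {L' : (Fin n' → ℝ) →ₗ[ℝ] (Fin n → ℝ)} (hL' : ∀ η, mult A (L' η) = mult A' η)
    (hLL' : ∀ η, L' (L η) = η) :
    (algebraSubst hA hL').comp (algebraSubst hA' hL) = AlgHom.id ℝ _ := by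
  refine Ideal.Quotient.algHom_ext _ (MvPolynomial.algHom_ext fun i => ?_)
  change algebraSubst hA hL' (algebraSubst hA' hL (Ideal.Quotient.mkₐ ℝ _ (MvPolynomial.X i))) =
    Ideal.Quotient.mkₐ ℝ _ (MvPolynomial.X i)
  rw [algebraSubst_mk, algebraSubst_mk, ← linearForm_single, linearSubst_linearForm,
    linearSubst_linearForm, hLL']

theorem isHomogeneous_linearForm (η : Fin n → ℝ) : (linearForm η).IsHomogeneous 1 :=
  MvPolynomial.IsHomogeneous.sum _ _ _ fun i _ => by
    simpa using (MvPolynomial.isHomogeneous_C (Fin n) (η i)).mul (MvPolynomial.isHomogeneous_X ℝ i)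

theorem map_algebraSubst_gradedPiece_le (hA' : A'.rank = n')
    {L : (Fin n → ℝ) →ₗ[ℝ] (Fin n' → ℝ)} (hL : ∀ η, mult A' (L η) = mult A η) (d : ℕ) :
    (gradedPiece A d).map (algebraSubst hA' hL).toLinearMap ≤ gradedPiece A' d := by
  rintro _ ⟨_, ⟨p, hp, rfl⟩, rfl⟩
  refine ⟨linearSubst L p, ?_, rfl⟩
  have := MvPolynomial.IsHomogeneous.aeval hp (fun i => linearForm (L (Pi.single i 1)))
    fun i => isHomogeneous_linearForm _
  rw [one_mul] at this
  exact this

theorem MultIsomorphic.gradedAlgIsomorphic (hA : A.rank = n) (hA' : A'.rank = n')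
    (h : MultIsomorphic A A') : GradedAlgIsomorphic A A' := by
  obtain ⟨L, hL⟩ := h
  have hL' : ∀ η, mult A ((L.symm : (Fin n' → ℝ) →ₗ[ℝ] (Fin n → ℝ)) η) = mult A' η :=
    fun η => by rw [← hL]; simp
  have h1 := algebraSubst_comp hA hA' (L := (L : (Fin n → ℝ) →ₗ[ℝ] (Fin n' → ℝ))) hL hL'
    (by simp)
  have h2 := algebraSubst_comp hA' hA hL' (L' := (L : (Fin n → ℝ) →ₗ[ℝ] (Fin n' → ℝ))) hL
    (by simp)
  refine ⟨AlgEquiv.ofAlgHom _ _ h2 h1, fun d => le_antisymm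
    (map_algebraSubst_gradedPiece_le hA' hL d) fun x hx => ?_⟩
  refine ⟨algebraSubst hA hL' x, map_algebraSubst_gradedPiece_le hA hL' d ⟨x, hx, rfl⟩, ?_⟩
  exact DFunLike.congr_fun h2 x

end Substitution

/-! ### Hamming weights and `z`-equivalence. -/

section ZEquivalence

variable {n m n' m' : ℕ} {A : Matrix (Fin n) (Fin m) ℝ} {A' : Matrix (Fin n') (Fin m') ℝ}

theorem mem_span_row_iff {v : Fin m → ℝ} :
    v ∈ Submodule.span ℝ (Set.range A.row) ↔ ∃ η, η ᵥ* A = v := by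
  rw [← range_vecMulLinear]
  rfl

theorem vecMul_injective (hA : A.rank = n) : Function.Injective A.vecMulLinear := by
  rw [← LinearMap.ker_eq_bot, LinearMap.ker_eq_bot']
  exact fun η h => (vecMul_eq_zero_iff hA).1 h

/-- The space of coefficient vectors is isomorphic to the row space. -/
noncomputable def rowSpaceEquiv (hA : A.rank = n) :
    (Fin n → ℝ) ≃ₗ[ℝ] Submodule.span ℝ (Set.range A.row) :=
  (LinearEquiv.ofInjective A.vecMulLinear (vecMul_injective hA)).trans
    (LinearEquiv.ofEq _ _ (range_vecMulLinear A))

theorem coe_rowSpaceEquiv (hA : A.rank = n) (η : Fin n → ℝ) :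
    (rowSpaceEquiv hA η : Fin m → ℝ) = η ᵥ* A := rfl

/-- Permuting and scaling the coordinates. -/
noncomputable def monomialEquiv (π : Fin m ≃ Fin m') (c : Fin m → ℝ) (hc : ∀ j, c j ≠ 0) :
    (Fin m' → ℝ) ≃ₗ[ℝ] (Fin m → ℝ) :=
  (LinearEquiv.funCongrLeft ℝ ℝ π).trans
    (LinearEquiv.piCongrRight fun j => LinearEquiv.smulOfNeZero ℝ ℝ (c j) (hc j))

theorem monomialEquiv_apply (π : Fin m ≃ Fin m') (c : Fin m → ℝ) (hc : ∀ j, c j ≠ 0)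
    (w : Fin m' → ℝ) : monomialEquiv π c hc w = fun j => w (π j) * c j := by
  ext j
  simp [monomialEquiv, LinearMap.funLeft, mul_comm]

theorem hammingNorm_monomialEquiv (π : Fin m ≃ Fin m') (c : Fin m → ℝ) (hc : ∀ j, c j ≠ 0)
    (w : Fin m' → ℝ) : hammingNorm (monomialEquiv π c hc w) = hammingNorm w := by
  rw [monomialEquiv_apply]
  refine Finset.card_equiv π fun j => ?_
  simp [hc j]

theorem ZEquiv.multIsomorphic (hA : A.rank = n) (hA' : A'.rank = n') (h : ZEquiv A A') :
    MultIsomorphic A A' := by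
  obtain ⟨-, π, c, hc, hV⟩ := h
  have hmap : (Submodule.span ℝ (Set.range A'.row)).map
      (monomialEquiv π c hc : (Fin m' → ℝ) →ₗ[ℝ] (Fin m → ℝ)) =
      Submodule.span ℝ (Set.range A.row) := by
    refine SetLike.coe_injective ?_
    rw [hV]
    ext v
    constructor
    · rintro ⟨w, hw, rfl⟩
      exact ⟨w, hw, monomialEquiv_apply π c hc w⟩
    · rintro ⟨w, hw, rfl⟩
      exact ⟨w, hw, monomialEquiv_apply π c hc w⟩
  let M : (Fin n' → ℝ) ≃ₗ[ℝ] (Fin n → ℝ) :=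
    ((rowSpaceEquiv hA').trans ((monomialEquiv π c hc).submoduleMap _)).trans
      ((LinearEquiv.ofEq _ _ hmap).trans (rowSpaceEquiv hA).symm)
  refine MultIsomorphic.symm ⟨M, fun η => ?_⟩
  have : M η ᵥ* A = monomialEquiv π c hc (η ᵥ* A') := by
    rw [← coe_rowSpaceEquiv hA, ← coe_rowSpaceEquiv hA']
    simp [M]
  rw [mult, mult, this, hammingNorm_monomialEquiv]

theorem exists_dotProduct_ne_zero {n : ℕ} {v y : Fin n → ℝ}
    (hy : y ∉ Submodule.span ℝ {v}) : ∃ h : Fin n → ℝ, h ⬝ᵥ v = 0 ∧ h ⬝ᵥ y ≠ 0 := by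
  obtain ⟨f, hf, hle⟩ := Submodule.exists_le_ker_of_notMem hy
  obtain ⟨h, rfl⟩ := (dotProductEquiv ℝ (Fin n)).surjective f
  exact ⟨h, by simpa using hle (Submodule.mem_span_singleton_self v), by simpa using hf⟩

/-- A vector orthogonal to `v` which is orthogonal only to those members of a finite family which
are multiples of `v`. -/
theorem exists_generic_orthogonal {n : ℕ} {ι : Type*} [Finite ι] (y : ι → Fin n → ℝ)
    (v : Fin n → ℝ) :
    ∃ h : Fin n → ℝ, ∀ j, h ⬝ᵥ y j = 0 ↔ y j ∈ Submodule.span ℝ {v} := by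
  -- Each `y j` off the line of `v` defines a nonzero functional on the space orthogonal to `v`;
  -- some vector there avoids the finitely many kernels.
  obtain ⟨h, hv, hh⟩ := Dual.exists_forall_mem_ne_zero_of_forall_exists
    (LinearMap.ker (dotProductEquiv ℝ (Fin n) v))
    (fun j : {j // y j ∉ Submodule.span ℝ {v}} => dotProductEquiv ℝ (Fin n) (y j)) (by
      rintro ⟨j, hj⟩
      obtain ⟨h, h1, h2⟩ := exists_dotProduct_ne_zero hj
      refine ⟨h, ?_, ?_⟩
      · simpa [dotProduct_comm] using h1
      · simpa [dotProduct_comm] using h2)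
  refine ⟨h, fun j => ⟨fun h0 => ?_, fun hj => ?_⟩⟩
  · by_contra hj
    exact hh ⟨j, hj⟩ (by simpa [dotProduct_comm] using h0)
  · refine dotProduct_eq_zero_of_mem_span ?_ hj
    rintro _ rfl
    simpa [dotProduct_comm] using hv

open Classical in
theorem card_span_singleton_eq {ι E : Type*} [Fintype ι] [AddCommGroup E] [Module ℝ E]
    (y : ι → E) {v : E} (hv : v ≠ 0) :
    (Finset.univ.filter fun j => Submodule.span ℝ {y j} = Submodule.span ℝ {v}).card +
      (Finset.univ.filter fun j => y j ∈ Submodule.span ℝ {(0 : E)}).card =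
      (Finset.univ.filter fun j => y j ∈ Submodule.span ℝ {v}).card := by
  rw [← Finset.card_union_of_disjoint]
  · congr 1
    ext j
    simp only [Finset.mem_union, Finset.mem_filter, Finset.mem_univ, true_and,
      Submodule.span_zero_singleton, Submodule.mem_bot]
    constructor
    · rintro (h | h)
      · rw [← h]; exact Submodule.mem_span_singleton_self _
      · rw [h]; exact zero_mem _
    · intro h
      by_cases h0 : y j = 0
      · exact Or.inr h0
      · obtain ⟨c, hc⟩ := Submodule.mem_span_singleton.1 h
        have hc0 : c ≠ 0 := by rintro rfl; exact h0 (by simpa using hc.symm)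
        refine Or.inl ?_
        rw [← hc]
        exact Submodule.span_singleton_smul_eq hc0.isUnit v
  · rw [Finset.disjoint_filter]
    rintro j - h h0
    rw [Submodule.span_zero_singleton, Submodule.mem_bot] at h0
    rw [h0, Submodule.span_zero_singleton, eq_comm, Submodule.span_singleton_eq_bot] at h
    exact hv h

open Classical in
/-- Two finite families of vectors such that every linear form vanishes on equally many members of
both agree up to a permutation and non-zero factors. -/
theorem exists_equiv_smul_eq {n : ℕ} {ι κ : Type*} [Fintype ι] [Fintype κ]
    (y : ι → Fin n → ℝ) (y' : κ → Fin n → ℝ)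
    (h : ∀ η : Fin n → ℝ, (Finset.univ.filter fun j => η ⬝ᵥ y j = 0).card =
      (Finset.univ.filter fun j => η ⬝ᵥ y' j = 0).card) :
    ∃ (π : ι ≃ κ) (c : ι → ℝ), ∀ j, c j ≠ 0 ∧ y j = c j • y' (π j) := by
  have hmem : ∀ v, (Finset.univ.filter fun j => y j ∈ Submodule.span ℝ {v}).card =
      (Finset.univ.filter fun j => y' j ∈ Submodule.span ℝ {v}).card := fun v => by
    -- One `η` generic for both families at once turns hyperplane counts into counts on the line of
    -- `v`.
    obtain ⟨η, hη⟩ := exists_generic_orthogonal (Sum.elim y y') v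
    have h1 := h η
    simp_rw [show ∀ j, η ⬝ᵥ y j = 0 ↔ _ from fun j => hη (Sum.inl j),
      show ∀ j, η ⬝ᵥ y' j = 0 ↔ _ from fun j => hη (Sum.inr j)] at h1
    exact h1
  have hspan : ∀ v, (Finset.univ.filter fun j => Submodule.span ℝ {y j} =
      Submodule.span ℝ {v}).card =
      (Finset.univ.filter fun j => Submodule.span ℝ {y' j} = Submodule.span ℝ {v}).card := by
    intro v
    by_cases hv : v = 0
    · have := hmem 0
      subst hv
      simpa [Submodule.span_zero_singleton, Submodule.span_singleton_eq_bot] using this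
    · have h1 := card_span_singleton_eq y hv
      have h2 := card_span_singleton_eq y' hv
      rw [hmem, hmem, ← h2] at h1
      exact Nat.add_right_cancel h1
  have hfib : ∀ S : Submodule ℝ (Fin n → ℝ),
      Nonempty ({j // Submodule.span ℝ {y j} = S} ≃ {j // Submodule.span ℝ {y' j} = S}) := by
    intro S
    rw [← Fintype.card_eq, Fintype.card_subtype, Fintype.card_subtype]
    by_cases hS : ∃ v, S = Submodule.span ℝ {v}
    · obtain ⟨v, rfl⟩ := hS
      exact hspan v
    · rw [Finset.filter_false_of_mem fun j _ hj => hS ⟨_, hj.symm⟩,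
        Finset.filter_false_of_mem fun j _ hj => hS ⟨_, hj.symm⟩]
      rfl
  -- Glue the bijections between the fibres of `j ↦ span {y j}` and `j ↦ span {y' j}`; vectors with
  -- equal spans differ by a nonzero factor.
  let e := fun S => Classical.choice (hfib S)
  have hπ : ∀ j, ∃ c : ℝ, c ≠ 0 ∧ y j = c • y' (Equiv.ofFiberEquiv e j) := fun j => by
    have := Equiv.ofFiberEquiv_map e j
    obtain ⟨z, hz⟩ := Submodule.span_singleton_eq_span_singleton.1 this
    exact ⟨z, z.ne_zero, hz.symm⟩
  choose c hc using hπ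
  exact ⟨_, c, hc⟩

theorem MultIsomorphic.zEquiv {A' : Matrix (Fin n') (Fin m) ℝ} (h : MultIsomorphic A A') :
    ZEquiv A A' := by
  classical
  obtain ⟨L, hL⟩ := h
  -- `B` is `A'` written in the coordinates transported by `L`, so both column families live in
  -- `ℝ^n` and can be compared.
  let B : Matrix (Fin n) (Fin m) ℝ := Matrix.of fun i => L (Pi.single i 1) ᵥ* A'
  have hB : ∀ η, η ᵥ* B = L η ᵥ* A' := fun η => by
    rw [vecMul_eq_sum]
    conv_rhs => rw [pi_eq_sum_univ' η]
    simp only [map_sum, map_smul, sum_vecMul, smul_vecMul]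
    rfl
  obtain ⟨π, c, hc⟩ := exists_equiv_smul_eq A.col B.col fun η => by
    have h1 := Finset.card_filter_add_card_filter_not (s := (Finset.univ : Finset (Fin m)))
      (fun j => η ⬝ᵥ A.col j = 0)
    have h2 := Finset.card_filter_add_card_filter_not (s := (Finset.univ : Finset (Fin m)))
      (fun j => η ⬝ᵥ B.col j = 0)
    have h3 : (Finset.univ.filter fun j => ¬ η ⬝ᵥ A.col j = 0).card = mult A η := by
      rw [mult_eq_card]; congr
    have h4 : (Finset.univ.filter fun j => ¬ η ⬝ᵥ B.col j = 0).card = mult A' (L η) := by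
      rw [mult_eq_card, ← hB]; congr
    have h5 := hL η
    omega
  have hval : ∀ η, η ᵥ* A = fun j => (L η ᵥ* A') (π j) * c j := fun η => by
    ext j
    rw [← hB]
    change η ⬝ᵥ A.col j = (η ⬝ᵥ B.col (π j)) * c j
    rw [(hc j).2, dotProduct_smul, smul_eq_mul, mul_comm]
  refine ⟨rfl, π, c, fun j => (hc j).1, ?_⟩
  ext v
  simp only [SetLike.mem_coe, mem_span_row_iff, Set.mem_ofPred_eq]
  constructor
  · rintro ⟨η, rfl⟩
    exact ⟨L η ᵥ* A', ⟨L η, rfl⟩, hval η⟩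
  · rintro ⟨_, ⟨η, rfl⟩, rfl⟩
    exact ⟨L.symm η, by rw [hval, L.apply_symm_apply]⟩

/-- A form generic relative to the columns vanishes on none of them, so the weight `m` is attained
and must also occur for `A'`. -/
theorem card_le_of_multIsomorphic (h0 : ∀ j, A.col j ≠ 0) (h : MultIsomorphic A A') : m ≤ m' := by
  obtain ⟨L, hL⟩ := h
  obtain ⟨η, hη⟩ := exists_generic_orthogonal A.col 0
  have h1 : mult A η = m := by
    rw [mult_eq_card, Finset.filter_true_of_mem, Finset.card_univ, Fintype.card_fin]
    intro j _ hj
    have := (hη j).1 hj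
    rw [Submodule.span_zero_singleton, Submodule.mem_bot] at this
    exact h0 j this
  have h2 : mult A' (L η) ≤ m' := by
    rw [mult]
    simpa using hammingNorm_le_card_fintype (x := L η ᵥ* A')
  rwa [hL, h1] at h2

end ZEquivalence

theorem GradedAlgIsomorphic.algIsomorphic {n m n' m' : ℕ} {A : Matrix (Fin n) (Fin m) ℝ}
    {A' : Matrix (Fin n') (Fin m') ℝ} (h : GradedAlgIsomorphic A A') : AlgIsomorphic A A' :=
  let ⟨e, _⟩ := h
  ⟨e⟩

end Zonotopal

theorem theorem2p4 {n₁ m₁ n₂ m₂ : ℕ}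
    (A₁ : Matrix (Fin n₁) (Fin m₁) ℝ) (A₂ : Matrix (Fin n₂) (Fin m₂) ℝ)
    (h₁ : A₁.rank = n₁) (h₂ : A₂.rank = n₂) :
    (Zonotopal.AlgIsomorphic A₁ A₂ ↔ Zonotopal.GradedAlgIsomorphic A₁ A₂) ∧
    (Zonotopal.ZEquiv A₁ A₂ → Zonotopal.GradedAlgIsomorphic A₁ A₂) ∧
    ((m₁ = m₂ ∨ ((∀ j, A₁.col j ≠ 0) ∧ ∀ j, A₂.col j ≠ 0)) →
      List.TFAE [Zonotopal.AlgIsomorphic A₁ A₂, Zonotopal.GradedAlgIsomorphic A₁ A₂,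
        Zonotopal.ZEquiv A₁ A₂]) := by
  have h12 : Zonotopal.AlgIsomorphic A₁ A₂ → Zonotopal.GradedAlgIsomorphic A₁ A₂ := fun h =>
    (h.multIsomorphic h₁ h₂).gradedAlgIsomorphic h₁ h₂
  have h32 : Zonotopal.ZEquiv A₁ A₂ → Zonotopal.GradedAlgIsomorphic A₁ A₂ := fun h =>
    (h.multIsomorphic h₁ h₂).gradedAlgIsomorphic h₁ h₂
  refine ⟨⟨h12, fun h => h.algIsomorphic⟩, h32, fun hm => ?_⟩
  have h13 : Zonotopal.AlgIsomorphic A₁ A₂ → Zonotopal.ZEquiv A₁ A₂ := fun h => by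
    have hM := h.multIsomorphic h₁ h₂
    have hm' : m₁ = m₂ := hm.elim id fun h0 => le_antisymm
      (Zonotopal.card_le_of_multIsomorphic h0.1 hM)
      (Zonotopal.card_le_of_multIsomorphic h0.2 hM.symm)
    subst hm'
    exact hM.zEquiv
  tfae_have 1 → 3 := h13
  tfae_have 3 → 2 := h32
  tfae_have 2 → 1 := fun h => h.algIsomorphic
  tfae_finish
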